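/- Let $X$ be a standard Borel space with a Borel measure $\mu$. Call an equivalence relation $F$ on $X$ finite Borel if $F$ is a Borel subset of $X\times X$ and every $F$-class is finite. Let $E$ be a hyperfinite equivalence relation on $X$, i.e. $E=\bigcup_n E_n$ for some increasing sequence $(E_n)_{n\in\mathbb N}$ of finite Borel equivalence relations on $X$; any such sequence is called a witness to the hyperfiniteness of $E$. Suppose that $E$ is $\mu$-preserving, i.e. $\mu(\varphi(A))=\mu(A)$ for every Borel set $A\subseteq X$ and every injective Borel map $\varphi:A\to X$ such that $(x,\varphi(x))\in E$ for all $x\in A$. Let $w:X\to[0,\infty)$ be a Borel function with $w\in L^1(X,\mu)$, and let $\mu_w$ be the measure given by $d\mu_w=w\,d\mu$. For $f:X\to\mathbb R$ and a finite Borel equivalence relation $F$ put $$A^w_f[F](x)=\frac{\sum_{y\in[x]_F}f(y)\,w(y)}{\sum_{y\in[x]_F}w(y)}$$ if the denominator is nonzero, and $A^w_f[F](x)=0$ otherwise. Theorem (Pointwise ergodic theorem for hyperfinite equivalence relations). For every $f\in L^1(X,\mu_w)$ and every witness $(E_n)_n$ to the hyperfiniteness of $E$, the limit $$A^w_f[E](x)=\lim_{n\to\infty}A^w_f[E_n](x)$$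 exists in $\mathbb R$ for $\mu$-a.e. $x\in X$, and it does not depend on the witness modulo $\mu$-null sets: for any two witnesses the corresponding limits are equal $\mu$-a.e. Furthermore, $A^w_f[E]\in L^1(X,\mu_w)$ and (a) $\int_Y A^w_f[E]\,d\mu_w=\int_Y f\,d\mu_w$ for every $E$-invariant Borel set $Y\subseteq X$; (b) $\|A^w_f[E]\|_{L^1(\mu_w)}\le\|f\|_{L^1(\mu_w)}$. -/

import Mathlib

open MeasureTheory Filter Topology

noncomputable section

namespace HyperfiniteMeans

variable {X : Type*} [MeasurableSpace X]

/-- A finite Borel equivalence relation: its graph is a Borel subset of `X × X` and all of its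
classes are finite. -/
structure IsFiniteBorel (F : Setoid X) : Prop where
  measurableSet_graph : MeasurableSet {p : X × X | F p.1 p.2}
  finite_class : ∀ x, {y | F x y}.Finite

/-- `(E n)` witnesses the hyperfiniteness of `E`: it is an increasing sequence of finite Borel
equivalence relations whose union is `E`. -/
structure IsHyperfiniteWitness (E : Setoid X) (En : ℕ → Setoid X) : Prop where
  isFiniteBorel : ∀ n, IsFiniteBorel (En n)
  monotone : Monotone En
  exhausts : ∀ x y, E x y ↔ ∃ n, En n x y

/-- Hyperfinite (Borel) equivalence relations. -/
def IsHyperfinite (E : Setoid X) : Prop :=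
  ∃ En : ℕ → Setoid X, IsHyperfiniteWitness E En

/-- `E` preserves `μ` (equivalently `μ` is `E`-invariant): every partial Borel injection
`φ : A → X`, with `A` Borel, whose graph is contained in `E` preserves `μ`. The values of `φ`
outside `A` are irrelevant. -/
def PreservesMeasure (E : Setoid X) (μ : Measure X) : Prop :=
  ∀ (A : Set X) (φ : X → X), MeasurableSet A → Measurable φ → Set.InjOn φ A →
    (∀ x ∈ A, E x (φ x)) → μ (φ '' A) = μ A

/-- The set `Y` is a union of `E`-classes. -/
def IsInvariant (E : Setoid X) (Y : Set X) : Prop :=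
  ∀ x y, E x y → x ∈ Y → y ∈ Y

/-- The `w`-weight `∑ y ∈ U, w y` of a finite set `U`. -/
def weightOf (w : X → ℝ) (U : Set X) : ℝ := ∑ᶠ y ∈ U, w y

open Classical in
/-- The `w`-weighted mean of `f` over a finite set `U`. -/
def setMean (w f : X → ℝ) (U : Set X) : ℝ :=
  if weightOf w U ≠ 0 then (∑ᶠ y ∈ U, f y * w y) / weightOf w U else 0

/-- The `w`-weighted mean of `f` over a finite equivalence relation `F`: the function that sends
`x` to the mean of `f` over the `F`-class of `x`. -/
def relMean (w f : X → ℝ) (F : Setoid X) (x : X) : ℝ := setMean w f {y | F x y}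

/-- The measure `μ_w` given by `dμ_w = w dμ`. -/
def weightedMeasure (μ : Measure X) (w : X → ℝ) : Measure X :=
  μ.withDensity fun x => ENNReal.ofReal (w x)

end HyperfiniteMeans

end

/-! Averaging over the classes of a finite Borel `F ≤ E` is conditional expectation for `μ_w`, given
the σ-algebra of Borel `F`-invariant sets (`IsFiniteBorel.relMean_ae_eq_condExp`). This rests on the
mass transport principle `IsFiniteBorel.mass_transport`: invariance of `μ` makes the total mass sent
along `F` equal to the total mass received.

Along a witness these σ-algebras decrease, and their intersection is the σ-algebra of Borel
`E`-invariant sets, whatever the witness. Lévy's downward theorem (`tendsto_ae_condExp_iInf`) thus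
gives convergence `μ_w`-a.e. to the conditional expectation of `f` given the latter; (a) and (b) are
standard properties of this limit. Since `E`-saturations of `μ`-null sets are null, and means are
constant on classes, convergence extends to `μ`-a.e. point of every class where `w` is not
identically zero. On the other classes all means are 0.

Mass transport needs `F` to be a countable union of Borel graphs of partial injections, which is
obtained from Novikov's separation theorem. -/

open MeasureTheory Filter Topology

noncomputable section

namespace HyperfiniteMeans

/-! ### Novikov separation and Borel sets with finite sections. -/

section Separation

/-- The sets `A n` can be enlarged to measurable sets with empty intersection. -/
def JointlySeparable {α : Type*} [MeasurableSpace α] (A : ℕ → Set α) : Prop :=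
  ∃ B : ℕ → Set α, (∀ n, A n ⊆ B n) ∧ (∀ n, MeasurableSet (B n)) ∧ ⋂ n, B n = ∅

/-- Unite the enlargements of the pieces at index `m` and intersect them at the others: a common
point would lie in all enlargements belonging to one piece. Contrapositively, non-separability
passes to some piece. -/
theorem JointlySeparable.of_iUnion {α : Type*} [MeasurableSpace α] {A : ℕ → Set α} {m : ℕ}
    {C : ℕ → Set α} (hC : A m = ⋃ v, C v)
    (h : ∀ v, JointlySeparable (Function.update A m (C v))) : JointlySeparable A := by
  choose B hAB hB hemp using h
  refine ⟨fun n => if n = m then ⋃ v, B v m else ⋂ v, B v n, fun n => ?_, fun n => ?_, ?_⟩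
  · by_cases hn : n = m
    · subst hn
      simp only [if_true, hC]
      exact Set.iUnion_mono fun v => by simpa using hAB v n
    · simp only [hn, if_false]
      exact Set.subset_iInter fun v => by simpa [hn] using hAB v n
  · dsimp only
    split_ifs
    · exact MeasurableSet.iUnion fun v => hB v m
    · exact MeasurableSet.iInter fun v => hB v n
  · refine Set.eq_empty_of_forall_notMem fun x hx => ?_
    rw [Set.mem_iInter] at hx
    have hm := hx m
    simp only [if_true, Set.mem_iUnion] at hm
    obtain ⟨v, hv⟩ := hm
    have : x ∈ ⋂ n, B v n := by
      refine Set.mem_iInter.2 fun n => ?_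
      by_cases hn : n = m
      · rwa [hn]
      · have := hx n
        simp only [hn, if_false, Set.mem_iInter] at this
        exact this v
    rw [hemp v] at this
    exact this

/-- The set of sequences whose `k`-th term is `z (Nat.pair n k)` whenever `Nat.pair n k < t`. -/
def rowCylinder (z : ℕ → ℕ) (t n : ℕ) : Set (ℕ → ℕ) :=
  {u | ∀ k, Nat.pair n k < t → u k = z (Nat.pair n k)}

theorem rowCylinder_congr {z z' : ℕ → ℕ} {t : ℕ} (h : ∀ i < t, z i = z' i) (n : ℕ) :
    rowCylinder z t n = rowCylinder z' t n := by
  ext u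
  exact forall₂_congr fun k hk => by rw [h _ hk]

/-- Stage `t`, decoded as a pair `(m, k)`, fixes entry `k` of row `m`. Only the `m`-th set is cut
into countably many pieces, so `JointlySeparable.of_iUnion` applies. -/
theorem exists_rowCylinder_update_not_jointlySeparable {α : Type*} [MeasurableSpace α]
    {f : ℕ → (ℕ → ℕ) → α} {z : ℕ → ℕ} {t : ℕ}
    (h : ¬ JointlySeparable fun n => f n '' rowCylinder z t n) :
    ∃ v, ¬ JointlySeparable fun n => f n '' rowCylinder (Function.update z t v) (t + 1) n := by
  contrapose! h
  set m := (Nat.unpair t).1 with hm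
  set k := (Nat.unpair t).2 with hk
  have ht : Nat.pair m k = t := Nat.pair_unpair t
  refine JointlySeparable.of_iUnion (m := m)
    (C := fun v => f m '' rowCylinder (Function.update z t v) (t + 1) m) ?_ fun v => ?_
  · rw [← Set.image_iUnion]
    congr 1
    ext u
    simp only [rowCylinder, Set.mem_ofPred_eq, Set.mem_iUnion]
    constructor
    · intro hu
      refine ⟨u k, fun j hj => ?_⟩
      by_cases hjt : Nat.pair m j = t
      · have : j = k := by
          rw [← ht] at hjt
          exact (Nat.pair_eq_pair.1 hjt).2
        rw [hjt, Function.update_self, this]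
      · rw [Function.update_of_ne hjt]
        exact hu j (by omega)
    · rintro ⟨v, hv⟩ j hj
      rw [hv j (by omega), Function.update_of_ne (by omega)]
  · convert h v using 1
    funext n
    by_cases hn : n = m
    · subst hn
      simp
    · rw [Function.update_of_ne hn]
      congr 1
      ext u
      simp only [rowCylinder, Set.mem_ofPred_eq]
      refine forall_congr' fun j => ?_
      have : Nat.pair n j ≠ t := by
        rw [← ht]
        exact fun hh => hn (Nat.pair_eq_pair.1 hh).1
      rw [Function.update_of_ne this]
      exact ⟨fun H hj => H (by omega), fun H hj => H (by omega)⟩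

theorem exists_rowCylinder_subset {U : Set (ℕ → ℕ)} (hU : IsOpen U) (z : ℕ → ℕ) (n : ℕ)
    (hz : (fun k => z (Nat.pair n k)) ∈ U) : ∃ t₀, ∀ t ≥ t₀, rowCylinder z t n ⊆ U := by
  obtain ⟨s, ⟨x, N, rfl⟩, hx, hs⟩ :=
    (PiNat.isTopologicalBasis_cylinders (fun _ : ℕ => ℕ)).exists_subset_of_mem_open hz hU
  obtain ⟨t₀, ht₀⟩ := ((Finset.range N).image (Nat.pair n)).bddAbove
  refine ⟨t₀ + 1, fun t ht u hu => hs ?_⟩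
  rw [PiNat.mem_cylinder_iff] at hx ⊢
  intro i hi
  rw [← hx i hi]
  refine hu i ?_
  have : Nat.pair n i ≤ t₀ := ht₀ (by
    simp only [Finset.coe_image, Set.mem_image]
    exact ⟨i, by simpa using hi, rfl⟩)
  omega

/-- If separation fails, it fails at every stage along a single `z` that codes one point of Baire
space per index. The ranges have no common point, so the images of rows `0` and some `i` differ. By
continuity, disjoint open neighbourhoods of these images contain the two corresponding sets at a
late stage; together with `univ` at all other indices they separate that stage. -/
theorem jointlySeparable_range {α : Type*} [TopologicalSpace α] [T2Space α] [MeasurableSpace α]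
    [OpensMeasurableSpace α] {f : ℕ → (ℕ → ℕ) → α} (hf : ∀ n, Continuous (f n))
    (h : ⋂ n, Set.range (f n) = ∅) : JointlySeparable fun n => Set.range (f n) := by
  by_contra hsep
  choose! v hv using fun (z : ℕ → ℕ) (t : ℕ) =>
    exists_rowCylinder_update_not_jointlySeparable (f := f) (z := z) (t := t)
  let Z : ℕ → ℕ → ℕ := fun t => Nat.rec (fun _ => 0) (fun t z => Function.update z t (v z t)) t
  have hZsucc : ∀ t, Z (t + 1) = Function.update (Z t) t (v (Z t) t) := fun t => rfl
  have hZ : ∀ t, ¬ JointlySeparable fun n => f n '' rowCylinder (Z t) t n := by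
    intro t
    induction t with
    | zero => simpa [rowCylinder] using hsep
    | succ t ih => exact hv _ _ ih
  let z : ℕ → ℕ := fun t => Z (t + 1) t
  have hzZ : ∀ t, ∀ i < t, Z t i = z i := by
    intro t
    induction t with
    | zero => simp
    | succ t ih =>
      intro i hi
      rcases Nat.lt_succ_iff_lt_or_eq.1 hi with hi | rfl
      · rw [hZsucc, Function.update_of_ne hi.ne, ih i hi]
      · rfl
  have hz : ∀ t, ¬ JointlySeparable fun n => f n '' rowCylinder z t n := by
    intro t
    simpa only [rowCylinder_congr (hzZ t)] using hZ t
  have hne : ∃ i, f i (fun k => z (Nat.pair i k)) ≠ f 0 (fun k => z (Nat.pair 0 k)) := by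
    by_contra! hall
    have : f 0 (fun k => z (Nat.pair 0 k)) ∈ ⋂ n, Set.range (f n) :=
      Set.mem_iInter.2 fun n => ⟨_, hall n⟩
    rw [h] at this
    exact this
  obtain ⟨i, hi⟩ := hne
  have hi0 : i ≠ 0 := by
    rintro rfl
    exact hi rfl
  obtain ⟨U, V, hU, hV, hiU, h0V, hUV⟩ := t2_separation hi
  obtain ⟨t₁, ht₁⟩ := exists_rowCylinder_subset (hU.preimage (hf i)) z i hiU
  obtain ⟨t₂, ht₂⟩ := exists_rowCylinder_subset (hV.preimage (hf 0)) z 0 h0V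
  refine hz (max t₁ t₂) ⟨fun n => if n = i then U else if n = 0 then V else Set.univ,
    fun n => ?_, fun n => ?_, ?_⟩
  · dsimp only
    split_ifs with h1 h2
    · subst h1
      exact Set.image_subset_iff.2 (ht₁ _ (le_max_left _ _))
    · subst h2
      exact Set.image_subset_iff.2 (ht₂ _ (le_max_right _ _))
    · exact Set.subset_univ _
  · dsimp only
    split_ifs
    exacts [hU.measurableSet, hV.measurableSet, MeasurableSet.univ]
  · refine Set.eq_empty_of_forall_notMem fun x hx => ?_
    rw [Set.mem_iInter] at hx
    have h1 := hx i
    have h2 := hx 0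
    simp only [if_true, hi0.symm, if_false] at h1 h2
    exact Set.disjoint_left.1 hUV h1 h2

/-- **Novikov's separation theorem**: countably many analytic sets with empty intersection can be
enlarged to Borel sets with empty intersection. -/
theorem jointlySeparable_of_analyticSet {α : Type*} [TopologicalSpace α] [T2Space α]
    [MeasurableSpace α] [OpensMeasurableSpace α] {A : ℕ → Set α} (hA : ∀ n, AnalyticSet (A n))
    (h : ⋂ n, A n = ∅) : JointlySeparable A := by
  by_cases hemp : ∃ n, A n = ∅
  · obtain ⟨m, hm⟩ := hemp
    refine ⟨fun n => if n = m then ∅ else Set.univ, fun n => ?_, fun n => ?_, ?_⟩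
    · by_cases hn : n = m
      · simp [hn, hm]
      · simp [hn]
    · dsimp only
      split_ifs <;> simp
    · refine Set.eq_empty_of_forall_notMem fun x hx => ?_
      simpa using Set.mem_iInter.1 hx m
  · push Not at hemp
    have : ∀ n, ∃ f : (ℕ → ℕ) → α, Continuous f ∧ Set.range f = A n := by
      intro n
      have := hA n
      rw [AnalyticSet] at this
      exact this.resolve_left (hemp n).ne_empty
    choose f hf hfA using this
    have := jointlySeparable_range hf (by simpa only [hfA] using h)
    simpa only [hfA] using this

/-- A Borel set with finite sections is a countable union of Borel graphs of partial functions. -/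
theorem exists_measurable_injOn_fst_cover {X Y : Type*} [MeasurableSpace X] [StandardBorelSpace X]
    [MeasurableSpace Y] [StandardBorelSpace Y] {B : Set (X × Y)} (hB : MeasurableSet B)
    (hfin : ∀ x, {y | (x, y) ∈ B}.Finite) :
    ∃ G : ℕ → Set (X × Y), (∀ k, MeasurableSet (G k)) ∧ (∀ k, Set.InjOn Prod.fst (G k)) ∧
      ⋃ k, G k = B := by
  let := upgradeStandardBorel X
  let := upgradeStandardBorel Y
  obtain ⟨b, hbc, -, hb⟩ := TopologicalSpace.exists_countable_basis Y
  -- The empty set is inserted so that the family can be enumerated even if the basis is empty.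
  obtain ⟨U, hUb⟩ := (hbc.insert ∅).exists_eq_range (Set.insert_nonempty _ _)
  have hUo : ∀ n, IsOpen (U n) := fun n => by
    have : U n ∈ insert ∅ b := hUb ▸ Set.mem_range_self n
    rcases this with h | h
    · rw [h]; exact isOpen_empty
    · exact hb.isOpen h
  -- `A n` collects the points of `B` that `U n` does not isolate in their section. No point lies in
  -- every `A n`, because finite sections are discrete, and `B \ A n` is a graph. As `A n` is only
  -- analytic, Novikov's theorem is used to replace it by a larger Borel set.
  let A : ℕ → Set (X × Y) := fun n => {p | p ∈ B ∧
    ∃ y', p.2 ∉ U n ∨ (y' ≠ p.2 ∧ y' ∈ U n ∧ (p.1, y') ∈ B)}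
  have hA : ∀ n, AnalyticSet (A n) := by
    intro n
    have hm : MeasurableSet {q : (X × Y) × Y | q.1 ∈ B ∧
        (q.1.2 ∉ U n ∨ (q.2 ≠ q.1.2 ∧ q.2 ∈ U n ∧ (q.1.1, q.2) ∈ B))} := by
      have hUm := (hUo n).measurableSet
      refine (measurable_fst hB).inter (MeasurableSet.union ?_ (MeasurableSet.inter ?_
        (MeasurableSet.inter ?_ ?_)))
      · exact (measurable_snd.comp measurable_fst) hUm.compl
      · exact (measurableSet_eq_fun measurable_snd (measurable_snd.comp measurable_fst)).compl
      · exact measurable_snd hUm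
      · exact ((measurable_fst.comp measurable_fst).prodMk measurable_snd) hB
    convert hm.analyticSet_image (measurable_fst (α := X × Y) (β := Y)) using 1
    ext p
    simp only [A, Set.mem_ofPred_eq, Set.mem_image, Prod.exists]
    constructor
    · rintro ⟨hp, y', hy'⟩
      exact ⟨p.1, p.2, y', ⟨hp, hy'⟩, rfl⟩
    · rintro ⟨x, y, y', ⟨hp, hy'⟩, rfl⟩
      exact ⟨hp, y', hy'⟩
  have hAe : ⋂ n, A n = ∅ := by
    refine Set.eq_empty_of_forall_notMem fun ⟨x, y⟩ hp => ?_
    rw [Set.mem_iInter] at hp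
    have hop : IsOpen ({y' | (x, y') ∈ B} \ {y})ᶜ :=
      ((hfin x).subset Set.sdiff_subset).isClosed.isOpen_compl
    obtain ⟨V, hV, hyV, hVs⟩ := hb.exists_subset_of_mem_open (a := y) (by simp) hop
    obtain ⟨n, rfl⟩ : V ∈ Set.range U := hUb ▸ Set.mem_insert_of_mem _ hV
    obtain ⟨-, y', h | ⟨hne, hyU, hyB⟩⟩ := hp n
    · exact h hyV
    · exact hVs hyU ⟨hyB, hne⟩
  obtain ⟨C, hAC, hC, hCe⟩ := jointlySeparable_of_analyticSet hA hAe
  refine ⟨fun n => B \ C n, fun n => hB.diff (hC n), fun n => ?_, ?_⟩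
  · rintro ⟨x, y⟩ ⟨hp, hpC⟩ ⟨x', y'⟩ ⟨hp', hpC'⟩ hxx
    obtain rfl : x = x' := hxx
    have h1 : (x, y) ∉ A n := fun h => hpC (hAC n h)
    have h2 : (x, y') ∉ A n := fun h => hpC' (hAC n h)
    by_contra hne
    have hyy : y' ≠ y := fun h => hne (by rw [h])
    refine h1 ⟨hp, y', Or.inr ⟨hyy, ?_, hp'⟩⟩
    by_contra hU
    exact h2 ⟨hp', y, Or.inl hU⟩
  · rw [← Set.sdiff_iInter, hCe, Set.sdiff_empty]

/-- A finite Borel equivalence relation is a countable disjoint union of Borel graphs of partial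
injections. -/
theorem IsFiniteBorel.exists_partition {X : Type*} [MeasurableSpace X] [StandardBorelSpace X]
    {F : Setoid X} (hF : IsFiniteBorel F) :
    ∃ G : ℕ → Set (X × X), (∀ k, MeasurableSet (G k)) ∧ (∀ k, Set.InjOn Prod.fst (G k)) ∧
      (∀ k, Set.InjOn Prod.snd (G k)) ∧ Pairwise (Function.onFun Disjoint G) ∧
      ⋃ k, G k = {p | F p.1 p.2} := by
  obtain ⟨G, hGm, hGi, hGu⟩ := exists_measurable_injOn_fst_cover hF.measurableSet_graph
    hF.finite_class
  -- Intersecting a graph with a transposed graph gives injectivity in both coordinates; by symmetry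
  -- of `F` these intersections still cover it.
  let K : ℕ → Set (X × X) := fun k => G k.unpair.1 ∩ Prod.swap ⁻¹' G k.unpair.2
  have hsub : ∀ k, disjointed K k ⊆ K k := disjointed_subset K
  refine ⟨disjointed K, fun k => ?_, fun k => ?_, fun k => ?_, disjoint_disjointed K, ?_⟩
  · exact MeasurableSet.disjointed (fun k => (hGm _).inter (measurable_swap (hGm _))) k
  · exact (hGi _).mono ((hsub k).trans Set.inter_subset_left)
  · intro p hp q hq hpq
    exact Prod.swap_injective (hGi _ (hsub k hp).2 (hsub k hq).2 hpq)
  · rw [iUnion_disjointed]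
    ext ⟨x, y⟩
    constructor
    · intro h
      obtain ⟨k, hk⟩ := Set.mem_iUnion.1 h
      rw [← hGu]
      exact Set.mem_iUnion.2 ⟨_, hk.1⟩
    · intro h
      have h' : (y, x) ∈ {p : X × X | F p.1 p.2} := F.symm h
      rw [← hGu] at h h'
      obtain ⟨i, hi⟩ := Set.mem_iUnion.1 h
      obtain ⟨j, hj⟩ := Set.mem_iUnion.1 h'
      refine Set.mem_iUnion.2 ⟨Nat.pair i j, ?_⟩
      simp only [K, Nat.unpair_pair]
      exact ⟨hi, hj⟩

end Separation

/-! ### Mass transport along finite Borel subrelations. -/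

section MassTransport

variable {X : Type*}

theorem setOf_class_eq {F : Setoid X} {x y : X} (h : F x y) : {z | F x z} = {z | F y z} :=
  Set.ext fun _ => ⟨fun hz => F.trans (F.symm h) hz, fun hz => F.trans h hz⟩

variable [MeasurableSpace X]

/-- The counting measure on the `F`-class of `x`. -/
def classMeasure (F : Setoid X) (x : X) : Measure X := Measure.count.restrict {y | F x y}

theorem IsFiniteBorel.measurableSet_class {F : Setoid X} (hF : IsFiniteBorel F) (x : X) :
    MeasurableSet {y | F x y} :=
  measurable_prodMk_left hF.measurableSet_graph

theorem IsFiniteBorel.ae_classMeasure {F : Setoid X} (hF : IsFiniteBorel F) (x : X) :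
    ∀ᵐ y ∂(classMeasure F x), F x y :=
  ae_restrict_mem (hF.measurableSet_class x)

/-- The counting measure on the `F`-class of `x`, moved to the vertical line above `x`. -/
def leftFiber (F : Setoid X) (x : X) : Measure (X × X) := (classMeasure F x).map fun y => (x, y)

/-- The counting measure on the `F`-class of `x`, moved to the horizontal line through `x`. -/
def rightFiber (F : Setoid X) (x : X) : Measure (X × X) := (classMeasure F x).map fun y => (y, x)

theorem lintegral_leftFiber (F : Setoid X) {c : X × X → ENNReal} (hc : Measurable c) (x : X) :
    ∫⁻ p, c p ∂(leftFiber F x) = ∫⁻ y, c (x, y) ∂(classMeasure F x) :=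
  lintegral_map hc measurable_prodMk_left

theorem lintegral_rightFiber (F : Setoid X) {c : X × X → ENNReal} (hc : Measurable c) (x : X) :
    ∫⁻ p, c p ∂(rightFiber F x) = ∫⁻ y, c (y, x) ∂(classMeasure F x) :=
  lintegral_map hc measurable_prodMk_right

variable [StandardBorelSpace X]

theorem count_section_of_injOn_fst {G : Set (X × X)}
    (hi : Set.InjOn Prod.fst G) (x : X) :
    Measure.count {y | (x, y) ∈ G} = (Prod.fst '' G).indicator (1 : X → ENNReal) x := by
  have hsub : {y | (x, y) ∈ G}.Subsingleton := fun y hy z hz =>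
    congrArg Prod.snd (hi hy hz rfl)
  by_cases hx : x ∈ Prod.fst '' G
  · rw [Set.indicator_of_mem hx]
    obtain ⟨⟨x', y⟩, hy, rfl⟩ := hx
    have : {y' | (x', y') ∈ G} = {y} := hsub.eq_singleton_of_mem hy
    simp [this]
  · rw [Set.indicator_of_notMem hx]
    have : {y | (x, y) ∈ G} = ∅ :=
      Set.eq_empty_of_forall_notMem fun y hy => hx ⟨(x, y), hy, rfl⟩
    simp [this]

theorem count_section_of_injOn_snd {G : Set (X × X)}
    (hi : Set.InjOn Prod.snd G) (x : X) :
    Measure.count {y | (y, x) ∈ G} = (Prod.snd '' G).indicator (1 : X → ENNReal) x := by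
  have h := count_section_of_injOn_fst (G := Prod.swap ⁻¹' G)
    (fun p hp q hq hpq => Prod.swap_injective (hi hp hq hpq)) x
  have h2 : Prod.fst '' (Prod.swap ⁻¹' G) = Prod.snd '' G := by
    ext z
    constructor
    · rintro ⟨p, hp, rfl⟩
      exact ⟨p.swap, hp, rfl⟩
    · rintro ⟨p, hp, rfl⟩
      exact ⟨p.swap, by simpa using hp, rfl⟩
  rw [h2] at h
  exact h

/-- `G` is the graph of a partial injection. By Lusin–Souslin its first projection is a measurable
embedding, so the injection extends to the globally Borel `φ` required by `PreservesMeasure`. -/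
theorem PreservesMeasure.measure_image_fst_eq {E : Setoid X} {μ : Measure X}
    (hμ : PreservesMeasure E μ) {G : Set (X × X)} (hG : MeasurableSet G)
    (h1 : Set.InjOn Prod.fst G) (h2 : Set.InjOn Prod.snd G) (hE : ∀ p ∈ G, E p.1 p.2) :
    μ (Prod.fst '' G) = μ (Prod.snd '' G) := by
  have : StandardBorelSpace G := hG.standardBorel
  have hemb : MeasurableEmbedding fun p : G => p.1.1 :=
    (measurable_fst.comp measurable_subtype_coe).measurableEmbedding fun p q hpq =>
      Subtype.ext (h1 p.2 q.2 hpq)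
  obtain ⟨φ, hφ, hφG⟩ := hemb.exists_measurable_extend (g := fun p : G => p.1.2)
    (measurable_snd.comp measurable_subtype_coe) fun x => ⟨x⟩
  have hφ' : ∀ p ∈ G, φ p.1 = p.2 := fun p hp => congrFun hφG ⟨p, hp⟩
  have himg : φ '' (Prod.fst '' G) = Prod.snd '' G := by
    rw [Set.image_image]
    exact Set.image_congr hφ'
  rw [← himg]
  refine (hμ _ φ (hG.image_of_measurable_injOn measurable_fst h1) hφ ?_ ?_).symm
  · rintro _ ⟨p, hp, rfl⟩ _ ⟨q, hq, rfl⟩ hpq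
    rw [hφ' p hp, hφ' q hq] at hpq
    rw [h2 hp hq hpq]
  · rintro _ ⟨p, hp, rfl⟩
    rw [hφ' p hp]
    exact hE p hp

/-- Each `G k` meets a vertical line in at most one point, so counting becomes a sum of indicators.
This gives measurability of the fibre and, after integration, reduces mass transport to the images
of single graphs. -/
theorem leftFiber_apply {F : Setoid X} {G : ℕ → Set (X × X)} (hG : ∀ k, MeasurableSet (G k))
    (h1 : ∀ k, Set.InjOn Prod.fst (G k)) (hd : Pairwise (Function.onFun Disjoint G))
    (hU : ⋃ k, G k = {p | F p.1 p.2}) {S : Set (X × X)} (hS : MeasurableSet S) (x : X) :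
    leftFiber F x S = ∑' k, (Prod.fst '' (S ∩ G k)).indicator (1 : X → ENNReal) x := by
  have hms : ∀ k, MeasurableSet {y | (x, y) ∈ S ∩ G k} := fun k =>
    measurable_prodMk_left (hS.inter (hG k))
  rw [leftFiber, Measure.map_apply measurable_prodMk_left hS, classMeasure,
    Measure.restrict_apply (measurable_prodMk_left hS)]
  have : Prod.mk x ⁻¹' S ∩ {y | F x y} = ⋃ k, {y | (x, y) ∈ S ∩ G k} := by
    ext y
    have : F x y ↔ ∃ k, (x, y) ∈ G k := by
      rw [← Set.mem_iUnion, hU]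
      rfl
    simp [this]
  rw [this, measure_iUnion _ hms]
  · exact tsum_congr fun k => count_section_of_injOn_fst ((h1 k).mono Set.inter_subset_right) x
  · intro i j hij
    refine Set.disjoint_left.2 fun y hy hy' => ?_
    exact Set.disjoint_left.1 (hd hij) hy.2 hy'.2

theorem rightFiber_apply {F : Setoid X} {G : ℕ → Set (X × X)} (hG : ∀ k, MeasurableSet (G k))
    (h2 : ∀ k, Set.InjOn Prod.snd (G k)) (hd : Pairwise (Function.onFun Disjoint G))
    (hU : ⋃ k, G k = {p | F p.1 p.2}) {S : Set (X × X)} (hS : MeasurableSet S) (x : X) :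
    rightFiber F x S = ∑' k, (Prod.snd '' (S ∩ G k)).indicator (1 : X → ENNReal) x := by
  have hms : ∀ k, MeasurableSet {y | (y, x) ∈ S ∩ G k} := fun k =>
    measurable_prodMk_right (hS.inter (hG k))
  rw [rightFiber, Measure.map_apply measurable_prodMk_right hS, classMeasure,
    Measure.restrict_apply (measurable_prodMk_right hS)]
  have : (fun y => (y, x)) ⁻¹' S ∩ {y | F x y} = ⋃ k, {y | (y, x) ∈ S ∩ G k} := by
    ext y
    have : F x y ↔ ∃ k, (y, x) ∈ G k := by
      rw [← Set.mem_iUnion, hU]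
      exact ⟨F.symm, F.symm⟩
    simp [this]
  rw [this, measure_iUnion _ hms]
  · exact tsum_congr fun k => count_section_of_injOn_snd ((h2 k).mono Set.inter_subset_right) x
  · intro i j hij
    refine Set.disjoint_left.2 fun y hy hy' => ?_
    exact Set.disjoint_left.1 (hd hij) hy.2 hy'.2

theorem IsFiniteBorel.measurable_leftFiber {F : Setoid X} (hF : IsFiniteBorel F) :
    Measurable (leftFiber F) := by
  obtain ⟨G, hG, h1, -, hd, hU⟩ := hF.exists_partition
  refine Measure.measurable_of_measurable_coe _ fun S hS => ?_
  simp only [leftFiber_apply hG h1 hd hU hS]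
  exact Measurable.tsum fun k => measurable_one.indicator
    ((hS.inter (hG k)).image_of_measurable_injOn measurable_fst
      ((h1 k).mono Set.inter_subset_right))

theorem IsFiniteBorel.measurable_rightFiber {F : Setoid X} (hF : IsFiniteBorel F) :
    Measurable (rightFiber F) := by
  obtain ⟨G, hG, -, h2, hd, hU⟩ := hF.exists_partition
  refine Measure.measurable_of_measurable_coe _ fun S hS => ?_
  simp only [rightFiber_apply hG h2 hd hU hS]
  exact Measurable.tsum fun k => measurable_one.indicator
    ((hS.inter (hG k)).image_of_measurable_injOn measurable_snd
      ((h2 k).mono Set.inter_subset_right))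

theorem IsFiniteBorel.bind_leftFiber_eq {E F : Setoid X} (hF : IsFiniteBorel F) {μ : Measure X}
    (hμ : PreservesMeasure E μ) (hFE : F ≤ E) :
    μ.bind (leftFiber F) = μ.bind (rightFiber F) := by
  obtain ⟨G, hG, h1, h2, hd, hU⟩ := hF.exists_partition
  ext S hS
  have hm1 : ∀ k, MeasurableSet (Prod.fst '' (S ∩ G k)) := fun k =>
    (hS.inter (hG k)).image_of_measurable_injOn measurable_fst
      ((h1 k).mono Set.inter_subset_right)
  have hm2 : ∀ k, MeasurableSet (Prod.snd '' (S ∩ G k)) := fun k =>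
    (hS.inter (hG k)).image_of_measurable_injOn measurable_snd
      ((h2 k).mono Set.inter_subset_right)
  rw [Measure.bind_apply hS hF.measurable_leftFiber.aemeasurable,
    Measure.bind_apply hS hF.measurable_rightFiber.aemeasurable]
  simp only [leftFiber_apply hG h1 hd hU hS, rightFiber_apply hG h2 hd hU hS]
  rw [lintegral_tsum fun k => (measurable_one.indicator (hm1 k)).aemeasurable,
    lintegral_tsum fun k => (measurable_one.indicator (hm2 k)).aemeasurable]
  refine tsum_congr fun k => ?_
  rw [lintegral_indicator_one (hm1 k), lintegral_indicator_one (hm2 k)]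
  refine hμ.measure_image_fst_eq (hS.inter (hG k)) ((h1 k).mono Set.inter_subset_right)
    ((h2 k).mono Set.inter_subset_right) fun p hp => hFE ?_
  have : p ∈ ⋃ k, G k := Set.mem_iUnion.2 ⟨k, hp.2⟩
  rw [hU] at this
  exact this

theorem IsFiniteBorel.measurable_lintegral_classMeasure {F : Setoid X} (hF : IsFiniteBorel F)
    {c : X × X → ENNReal} (hc : Measurable c) :
    Measurable fun x => ∫⁻ y, c (x, y) ∂(classMeasure F x) := by
  simp only [← lintegral_leftFiber F hc]
  exact (Measure.measurable_lintegral hc).comp hF.measurable_leftFiber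

/-- **Mass transport principle** for a finite Borel subrelation of a measure preserving
equivalence relation. -/
theorem IsFiniteBorel.mass_transport {E F : Setoid X} (hF : IsFiniteBorel F) {μ : Measure X}
    (hμ : PreservesMeasure E μ) (hFE : F ≤ E) {c : X × X → ENNReal} (hc : Measurable c) :
    ∫⁻ x, ∫⁻ y, c (x, y) ∂(classMeasure F x) ∂μ =
      ∫⁻ x, ∫⁻ y, c (y, x) ∂(classMeasure F x) ∂μ := by
  simp only [← lintegral_leftFiber F hc, ← lintegral_rightFiber F hc]
  rw [← Measure.lintegral_bind hF.measurable_leftFiber.aemeasurable hc.aemeasurable,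
    ← Measure.lintegral_bind hF.measurable_rightFiber.aemeasurable hc.aemeasurable,
    hF.bind_leftFiber_eq hμ hFE]

/-- The saturation of a null set is null. -/
theorem IsFiniteBorel.ae_forall_class {E F : Setoid X} (hF : IsFiniteBorel F) {μ : Measure X}
    (hμ : PreservesMeasure E μ) (hFE : F ≤ E) {p : X → Prop} (hp : ∀ᵐ x ∂μ, p x) :
    ∀ᵐ x ∂μ, ∀ y, F x y → p y := by
  obtain ⟨N, hpN, hN, hN0⟩ := exists_measurable_superset_of_null (ae_iff.1 hp)
  -- Each `x` sends mass 1 to every point of `N` in its class. Since `N` is null the total received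
  -- is 0, so almost no class contains a point of `N`.
  have hc : Measurable fun q : X × X => N.indicator (1 : X → ENNReal) q.2 :=
    (measurable_one.indicator hN).comp measurable_snd
  have h := hF.mass_transport hμ hFE hc
  have h0 : ∫⁻ x, ∫⁻ _, N.indicator (1 : X → ENNReal) x ∂(classMeasure F x) ∂μ = 0 := by
    rw [lintegral_eq_zero_of_ae_eq_zero]
    filter_upwards [measure_eq_zero_iff_ae_notMem.1 hN0] with x hx
    simp [hx]
  rw [h0, lintegral_eq_zero_iff (hF.measurable_lintegral_classMeasure hc)] at h
  filter_upwards [h] with x hx y hxy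
  by_contra hy
  have hyN : y ∈ N := hpN hy
  have h1 : classMeasure F x N = 0 := by
    rw [← lintegral_indicator_one hN]
    exact hx
  have h2 : classMeasure F x {y} = 0 := measure_mono_null (by simpa using hyN) h1
  rw [classMeasure, Measure.restrict_apply (measurableSet_singleton y),
    Set.inter_eq_left.2 (by simpa using hxy)] at h2
  simp at h2

end MassTransport

/-! ### Lévy's downward theorem. -/

section LevyDownward

/-- Orthogonal projections onto a decreasing sequence of closed subspaces converge strongly to the
orthogonal projection onto the intersection. -/
theorem tendsto_starProjection_iInf {𝕜 H ι : Type*} [RCLike 𝕜] [NormedAddCommGroup H]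
    [InnerProductSpace 𝕜 H] [CompleteSpace H] [Preorder ι] (U : ι → Submodule 𝕜 H)
    [∀ i, (U i).HasOrthogonalProjection] [(⨅ i, U i).HasOrthogonalProjection]
    (hU : Antitone U) (x : H) :
    Tendsto (fun i => (U i).starProjection x) atTop (𝓝 ((⨅ i, U i).starProjection x)) := by
  have hmono : Monotone fun i => (U i)ᗮ := fun i j hij => Submodule.orthogonal_le (hU hij)
  have hcl : (⨆ i, (U i)ᗮ).topologicalClosure = (⨅ i, U i)ᗮ := by
    rw [← Submodule.orthogonal_orthogonal_eq_closure, ← Submodule.iInf_orthogonal]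
    simp only [Submodule.orthogonal_orthogonal]
  have : (⨆ i, (U i)ᗮ).topologicalClosure.HasOrthogonalProjection := by
    rw [hcl]; infer_instance
  have key := Submodule.starProjection_tendsto_closure_iSup (fun i => (U i)ᗮ) hmono x
  simp only [hcl, Submodule.starProjection_orthogonal_val] at key
  simpa using (tendsto_const_nhds (x := x)).sub key

variable {Ω : Type*} {m0 : MeasurableSpace Ω} {μ : Measure Ω}

/-- The limsup of the `m n`-measurable versions ignores finitely many terms, hence is measurable for
every `m N`, and it still equals `f` almost everywhere. -/
theorem aestronglyMeasurable_iInf {m : ℕ → MeasurableSpace Ω} (hm : Antitone m)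
    {f : Ω → ℝ} (hf : ∀ n, AEStronglyMeasurable[m n] f μ) :
    AEStronglyMeasurable[⨅ n, m n] f μ := by
  choose g hg hfg using hf
  refine ⟨fun x => limsup (fun n => g n x) atTop, ?_, ?_⟩
  · refine Measurable.stronglyMeasurable ?_
    have h : ∀ N, Measurable[m N] fun x => limsup (fun n => g n x) atTop := by
      intro N
      have : (fun x => limsup (fun n => g n x) atTop) =
          fun x => limsup (fun n => g (n + N) x) atTop := by
        funext x
        exact (limsup_nat_add (fun n => g n x) N).symm
      rw [this]
      exact Measurable.limsup fun n =>
        ((hg (n + N)).mono (hm (Nat.le_add_left N n))).measurable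
    intro s hs
    exact MeasurableSpace.measurableSet_iInf.2 fun N => h N hs
  · filter_upwards [ae_all_iff.2 hfg] with x hx
    simp only [← hx]
    exact limsup_const _ |>.symm

theorem lpMeas_iInf [IsFiniteMeasure μ] {m : ℕ → MeasurableSpace Ω} (hm : Antitone m) :
    lpMeas ℝ ℝ (⨅ n, m n) 2 μ = ⨅ n, lpMeas ℝ ℝ (m n) 2 μ := by
  ext f
  simp only [Submodule.mem_iInf, mem_lpMeas_iff_aestronglyMeasurable]
  exact ⟨fun h n => h.mono (iInf_le m n), aestronglyMeasurable_iInf hm⟩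

/-- In `L²` conditional expectations are orthogonal projections onto the decreasing subspaces
`lpMeas`; finiteness of `μ` turns `L²` convergence into `L¹` convergence. -/
theorem tendsto_condExp_iInf_of_memLp_two [IsFiniteMeasure μ] {m : ℕ → MeasurableSpace Ω}
    (hm : Antitone m) (hle : ∀ n, m n ≤ m0) {f : Ω → ℝ} (hf : MemLp f 2 μ) :
    Tendsto (fun n => eLpNorm (μ[f | m n] - μ[f | ⨅ n, m n]) 1 μ) atTop (𝓝 0) := by
  have hi : ⨅ n, m n ≤ m0 := (iInf_le m 0).trans (hle 0)
  have (n : ℕ) : Fact (m n ≤ m0) := ⟨hle n⟩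
  have : Fact (⨅ n, m n ≤ m0) := ⟨hi⟩
  have hEq := lpMeas_iInf (μ := μ) hm
  have : (⨅ n, lpMeas ℝ ℝ (m n) 2 μ).HasOrthogonalProjection := by
    rw [← hEq]; infer_instance
  have key := tendsto_starProjection_iInf (fun n => lpMeas ℝ ℝ (m n) 2 μ)
    (fun i j hij g hg => by
      rw [mem_lpMeas_iff_aestronglyMeasurable] at hg ⊢
      exact hg.mono (hm hij)) hf.toLp
  simp only [← hEq] at key
  rw [Lp.tendsto_Lp_iff_tendsto_eLpNorm'] at key
  have h2 : Tendsto (fun n => eLpNorm (μ[f | m n] - μ[f | ⨅ n, m n]) 2 μ) atTop (𝓝 0) := by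
    refine key.congr fun n => eLpNorm_congr_ae ?_
    exact (hf.condExpL2_ae_eq_condExp (𝕜 := ℝ) (hle n)).sub
      (hf.condExpL2_ae_eq_condExp (𝕜 := ℝ) hi)
  have h3 := ENNReal.Tendsto.mul_const
    (b := μ Set.univ ^ (1 / (1 : ENNReal).toReal - 1 / (2 : ENNReal).toReal)) h2
    (Or.inr (ENNReal.rpow_ne_top_of_nonneg (by norm_num) (measure_ne_top μ _)))
  rw [zero_mul] at h3
  refine tendsto_of_tendsto_of_tendsto_of_le_of_le tendsto_const_nhds h3 (fun _ => zero_le)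
    fun n => eLpNorm_le_eLpNorm_mul_rpow_measure_univ one_le_two ?_
  exact integrable_condExp.aestronglyMeasurable.sub integrable_condExp.aestronglyMeasurable

/-- Conditional expectations along a decreasing sequence of σ-algebras converge in `L¹`. -/
theorem tendsto_eLpNorm_condExp_iInf [IsFiniteMeasure μ] {m : ℕ → MeasurableSpace Ω}
    (hm : Antitone m) (hle : ∀ n, m n ≤ m0) {f : Ω → ℝ} (hf : Integrable f μ) :
    Tendsto (fun n => eLpNorm (μ[f | m n] - μ[f | ⨅ n, m n]) 1 μ) atTop (𝓝 0) := by
  have hi : ⨅ n, m n ≤ m0 := (iInf_le m 0).trans (hle 0)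
  rw [ENNReal.tendsto_nhds_zero]
  intro ε hε
  have hε3 : ε / 3 ≠ 0 := (ENNReal.div_pos hε.ne' (by simp)).ne'
  obtain ⟨s, hs, hs2⟩ : ∃ s : Ω → ℝ, eLpNorm (f - s) 1 μ < ε / 3 ∧ MemLp s 2 μ := by
    obtain ⟨s, hs, -⟩ := (memLp_one_iff_integrable.2 hf).exists_simpleFunc_eLpNorm_sub_lt
      ENNReal.one_ne_top hε3
    exact ⟨s, hs, s.memLp_of_isFiniteMeasure 2 μ⟩
  have hs1 : Integrable s μ := hs2.integrable one_le_two
  filter_upwards [ENNReal.tendsto_nhds_zero.1 (tendsto_condExp_iInf_of_memLp_two hm hle hs2)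
    (ε / 3) (pos_iff_ne_zero.2 hε3)] with n hn
  have hae : μ[f | m n] - μ[f | ⨅ n, m n] =ᵐ[μ] (μ[f - s | m n] +
      (μ[s | m n] - μ[s | ⨅ n, m n])) - μ[f - s | ⨅ n, m n] := by
    filter_upwards [condExp_sub hf hs1 (m n), condExp_sub hf hs1 (⨅ n, m n)] with x h1 h2
    simp only [Pi.sub_apply, Pi.add_apply] at h1 h2 ⊢
    rw [h1, h2]; ring
  have hmn : ∀ g : Ω → ℝ, AEStronglyMeasurable (μ[g | m n]) μ :=
    fun g => integrable_condExp.aestronglyMeasurable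
  have hmi : ∀ g : Ω → ℝ, AEStronglyMeasurable (μ[g | ⨅ n, m n]) μ :=
    fun g => integrable_condExp.aestronglyMeasurable
  calc eLpNorm (μ[f | m n] - μ[f | ⨅ n, m n]) 1 μ
      = eLpNorm ((μ[f - s | m n] +
      (μ[s | m n] - μ[s | ⨅ n, m n])) - μ[f - s | ⨅ n, m n]) 1 μ := eLpNorm_congr_ae hae
    _ ≤ (eLpNorm (μ[f - s | m n]) 1 μ + eLpNorm (μ[s | m n] - μ[s | ⨅ n, m n]) 1 μ) +
        eLpNorm (μ[f - s | ⨅ n, m n]) 1 μ :=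
      (eLpNorm_sub_le ((hmn _).add ((hmn _).sub (hmi _))) (hmi _) le_rfl).trans
        (add_le_add_left (eLpNorm_add_le (hmn _) ((hmn _).sub (hmi _)) le_rfl) _)
    _ ≤ (ε / 3 + ε / 3) + ε / 3 := by
      gcongr
      · exact (eLpNorm_condExp_le_eLpNorm _ le_rfl).trans hs.le
      · exact (eLpNorm_condExp_le_eLpNorm _ le_rfl).trans hs.le
    _ = ε := ENNReal.add_thirds ε

/-- Maximal inequality for conditional expectations along finitely many members of a decreasing
sequence of σ-algebras. -/
theorem mul_measure_exists_le_abs_condExp_le [IsFiniteMeasure μ] {m : ℕ → MeasurableSpace Ω}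
    (hm : Antitone m) (hle : ∀ n, m n ≤ m0) (f : Ω → ℝ) (ε : NNReal) (N : ℕ) :
    ε * μ {x | ∃ n ≤ N, (ε : ℝ) ≤ |(μ[f | m n]) x|} ≤ eLpNorm f 1 μ := by
  -- Reversing time up to `N` gives an increasing filtration, so Doob's maximal inequality applies
  -- to the absolute value of the martingale, written as its supremum with its negative.
  let ℱ : Filtration ℕ m0 :=
    ⟨fun k => m (N - k), fun i j hij => hm (Nat.sub_le_sub_left hij N), fun k => hle _⟩
  have hM : Martingale (fun k => μ[f | ℱ k]) ℱ μ := martingale_condExp f ℱ μ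
  have hsub := hM.submartingale.sup hM.neg.submartingale
  set M : ℕ → Ω → ℝ := (fun k => μ[f | ℱ k]) ⊔ -(fun k => μ[f | ℱ k]) with hMdef
  have hMabs : ∀ k x, M k x = |(μ[f | m (N - k)]) x| := fun k x => rfl
  have h := maximal_ineq hsub (fun k x => abs_nonneg _) (ε := ε) N
  calc ε * μ {x | ∃ n ≤ N, (ε : ℝ) ≤ |(μ[f | m n]) x|}
      ≤ ε * μ {ω | (ε : ℝ) ≤ (Finset.range (N + 1)).sup' Finset.nonempty_range_add_one
          fun k => M k ω} := by
        refine mul_le_mul_right (measure_mono ?_) _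
        rintro x ⟨n, hn, hx⟩
        have hmem : N - n ∈ Finset.range (N + 1) := Finset.mem_range.2 (by omega)
        refine Finset.le_sup'_of_le (fun k => M k x) hmem ?_
        rw [hMabs, Nat.sub_sub_self hn]
        exact hx
    _ ≤ _ := h
    _ ≤ ENNReal.ofReal (∫ x, M N x ∂μ) :=
        ENNReal.ofReal_le_ofReal (setIntegral_le_integral (hsub.integrable N)
          (Eventually.of_forall fun x => abs_nonneg _))
    _ = eLpNorm (μ[f | m 0]) 1 μ := by
        have : M N = fun x => ‖(μ[f | m 0]) x‖ := by
          funext x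
          rw [hMabs, Nat.sub_self, Real.norm_eq_abs]
        rw [this, ofReal_integral_norm_eq_lintegral_enorm integrable_condExp,
          eLpNorm_one_eq_lintegral_enorm]
    _ ≤ eLpNorm f 1 μ := eLpNorm_condExp_le_eLpNorm f le_rfl

theorem mul_measure_exists_le_abs_condExp_le' [IsFiniteMeasure μ] {m : ℕ → MeasurableSpace Ω}
    (hm : Antitone m) (hle : ∀ n, m n ≤ m0) (f : Ω → ℝ) (ε : NNReal) :
    ε * μ {x | ∃ n, (ε : ℝ) ≤ |(μ[f | m n]) x|} ≤ eLpNorm f 1 μ := by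
  have hU : {x | ∃ n, (ε : ℝ) ≤ |(μ[f | m n]) x|} =
      ⋃ N : ℕ, {x | ∃ n ≤ N, (ε : ℝ) ≤ |(μ[f | m n]) x|} := by
    ext x
    simp only [Set.mem_ofPred_eq, Set.mem_iUnion]
    exact ⟨fun ⟨n, hn⟩ => ⟨n, n, le_rfl, hn⟩, fun ⟨_, n, _, hn⟩ => ⟨n, hn⟩⟩
  have hmono : Monotone fun N : ℕ => {x | ∃ n ≤ N, (ε : ℝ) ≤ |(μ[f | m n]) x|} :=
    fun N N' hN x ⟨n, hn, hx⟩ => ⟨n, hn.trans hN, hx⟩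
  rw [hU, hmono.measure_iUnion, ENNReal.mul_iSup]
  exact iSup_le fun N => mul_measure_exists_le_abs_condExp_le hm hle f ε N

/-- **Lévy's downward theorem**: conditional expectations of an integrable function along a
decreasing sequence of σ-algebras converge almost everywhere. -/
theorem tendsto_ae_condExp_iInf [IsFiniteMeasure μ] {m : ℕ → MeasurableSpace Ω}
    (hm : Antitone m) (hle : ∀ n, m n ≤ m0) {f : Ω → ℝ} (hf : Integrable f μ) :
    ∀ᵐ x ∂μ, Tendsto (fun n => (μ[f | m n]) x) atTop (𝓝 ((μ[f | ⨅ n, m n]) x)) := by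
  have hi : ⨅ n, m n ≤ m0 := (iInf_le m 0).trans (hle 0)
  set g := μ[f | ⨅ n, m n] with hg
  have hgi : Integrable g μ := integrable_condExp
  -- From index `N` on, the error is itself the conditional expectation of the fixed function `μ[f |
  -- m N] - g`. The maximal inequality then bounds its later oscillations by an `L¹` norm that tends
  -- to 0 with `N`.
  have hdiff : ∀ N n, μ[μ[f | m N] - g | m (n + N)] =ᵐ[μ] μ[f | m (n + N)] - g := by
    intro N n
    have h1 := condExp_sub (μ := μ) (integrable_condExp (f := f) (m := m N)) hgi (m (n + N))
    have h2 : μ[μ[f | m N] | m (n + N)] =ᵐ[μ] μ[f | m (n + N)] :=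
      condExp_condExp_of_le (hm (Nat.le_add_left N n)) (hle N)
    have h3 : μ[g | m (n + N)] = g :=
      condExp_of_stronglyMeasurable (hle _)
        (stronglyMeasurable_condExp.mono (iInf_le m _)) hgi
    rw [h3] at h1
    exact h1.trans (h2.sub EventuallyEq.rfl)
  have hsmall : ∀ ε : NNReal, 0 < ε →
      μ {x | ∃ᶠ n in atTop, (ε : ℝ) ≤ |(μ[f | m n]) x - g x|} = 0 := by
    intro ε hε
    have hbound : ∀ N, ε * μ {x | ∃ᶠ n in atTop, (ε : ℝ) ≤ |(μ[f | m n]) x - g x|} ≤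
        eLpNorm (μ[f | m N] - g) 1 μ := by
      intro N
      refine le_trans ?_ (mul_measure_exists_le_abs_condExp_le' (m := fun n => m (n + N))
        (fun i j hij => hm (Nat.add_le_add_right hij N)) (fun n => hle _) (μ[f | m N] - g) ε)
      refine mul_le_mul_right (measure_mono_ae ?_) _
      filter_upwards [ae_all_iff.2 (hdiff N)] with x hx hfr
      obtain ⟨n, hn, hnx⟩ := frequently_atTop.1 hfr N
      refine ⟨n - N, ?_⟩
      rw [hx, Nat.sub_add_cancel hn]
      exact hnx
    have hz : ε * μ {x | ∃ᶠ n in atTop, (ε : ℝ) ≤ |(μ[f | m n]) x - g x|} ≤ 0 :=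
      ge_of_tendsto' (tendsto_eLpNorm_condExp_iInf hm hle hf) hbound
    simpa [hε.ne'] using hz
  obtain ⟨u, -, hupos, hu⟩ := exists_seq_strictAnti_tendsto (0 : NNReal)
  have hall : ∀ᵐ x ∂μ, ∀ k, ¬ ∃ᶠ n in atTop, (u k : ℝ) ≤ |(μ[f | m n]) x - g x| :=
    ae_all_iff.2 fun k => measure_eq_zero_iff_ae_notMem.1 (hsmall (u k) (hupos k))
  filter_upwards [hall] with x hx
  rw [Metric.tendsto_nhds]
  intro ε hε
  obtain ⟨k, hk⟩ := (hu.eventually (gt_mem_nhds (show (0 : NNReal) < ⟨ε, hε.le⟩ from hε))).exists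
  filter_upwards [not_frequently.1 (hx k)] with n hn
  rw [Real.dist_eq]
  exact (not_le.1 hn).trans hk

end LevyDownward

/-! ### Weighted means as conditional expectations. -/

section Means

variable {X : Type*}

/-- The sum of `h` over the `F`-class of `x`. -/
def classSum (F : Setoid X) (h : X → ℝ) (x : X) : ℝ := ∑ᶠ y ∈ {y | F x y}, h y

theorem relMean_eq_div (w f : X → ℝ) (F : Setoid X) (x : X) :
    relMean w f F x = classSum F (fun y => f y * w y) x / classSum F w x := by
  unfold relMean setMean
  split_ifs with h
  · rfl
  · have : classSum F w x = 0 := not_not.1 h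
    simp [this]

theorem relMean_congr_class {w f : X → ℝ} {F : Setoid X} {x y : X} (h : F x y) :
    relMean w f F x = relMean w f F y := by
  unfold relMean
  rw [setOf_class_eq h]

theorem classSum_congr_class {h : X → ℝ} {F : Setoid X} {x y : X} (hxy : F x y) :
    classSum F h x = classSum F h y := by
  unfold classSum
  rw [setOf_class_eq hxy]

theorem classSum_nonneg {h : X → ℝ} (hh : ∀ x, 0 ≤ h x) (F : Setoid X) (x : X) :
    0 ≤ classSum F h x :=
  finsum_nonneg fun y => finsum_nonneg fun _ => hh y

theorem relMean_nonneg {w f : X → ℝ} (hw0 : ∀ x, 0 ≤ w x) (hf0 : ∀ x, 0 ≤ f x) (F : Setoid X)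
    (x : X) : 0 ≤ relMean w f F x := by
  rw [relMean_eq_div]
  exact div_nonneg (classSum_nonneg (fun y => mul_nonneg (hf0 y) (hw0 y)) F x)
    (classSum_nonneg hw0 F x)

/-- The union of the `E`-classes on which `w` does not vanish identically. -/
def weightSupport (E : Setoid X) (w : X → ℝ) : Set X := {x | ∃ y, E x y ∧ w y ≠ 0}

variable [MeasurableSpace X]

theorem IsFiniteBorel.classSum_sub {F : Setoid X} (hF : IsFiniteBorel F) (h k : X → ℝ) (x : X) :
    classSum F (fun y => h y - k y) x = classSum F h x - classSum F k x :=
  finsum_mem_sub_distrib _ _ (hF.finite_class x)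

theorem IsFiniteBorel.le_classSum {F : Setoid X} (hF : IsFiniteBorel F) {h : X → ℝ}
    (hh : ∀ x, 0 ≤ h x) {x y : X} (hxy : F x y) : h y ≤ classSum F h x := by
  unfold classSum
  rw [finsum_mem_eq_finite_toFinset_sum _ (hF.finite_class x)]
  exact Finset.single_le_sum (fun i _ => hh i) (by simpa using hxy)

theorem IsFiniteBorel.ofReal_classSum [MeasurableSingletonClass X] {F : Setoid X}
    (hF : IsFiniteBorel F) {h : X → ℝ} (hh : ∀ x, 0 ≤ h x) (x : X) :
    ENNReal.ofReal (classSum F h x) = ∫⁻ y, ENNReal.ofReal (h y) ∂(classMeasure F x) := by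
  have hs := (hF.finite_class x).coe_toFinset
  unfold classSum classMeasure
  rw [finsum_mem_eq_finite_toFinset_sum _ (hF.finite_class x),
    ENNReal.ofReal_sum_of_nonneg fun i _ => hh i]
  conv_rhs => rw [← hs]
  rw [lintegral_finset]
  simp

theorem IsFiniteBorel.relMean_sub {F : Setoid X} (hF : IsFiniteBorel F) (w f g : X → ℝ) (x : X) :
    relMean w (f - g) F x = relMean w f F x - relMean w g F x := by
  simp only [relMean_eq_div, Pi.sub_apply, sub_mul, hF.classSum_sub, sub_div]

/-- The σ-algebra of Borel `E`-invariant sets. -/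
@[reducible] def invariantSpace (E : Setoid X) : MeasurableSpace X where
  MeasurableSet' s := MeasurableSet s ∧ IsInvariant E s
  measurableSet_empty := ⟨MeasurableSet.empty, fun _ _ _ h => h⟩
  measurableSet_compl s hs := ⟨hs.1.compl, fun x y hxy hx hy => hx (hs.2 y x (E.symm hxy) hy)⟩
  measurableSet_iUnion s hs := ⟨MeasurableSet.iUnion fun n => (hs n).1, fun x y hxy hx => by
    obtain ⟨n, hn⟩ := Set.mem_iUnion.1 hx
    exact Set.mem_iUnion.2 ⟨n, (hs n).2 x y hxy hn⟩⟩

theorem invariantSpace_le (E : Setoid X) : invariantSpace E ≤ ‹MeasurableSpace X› :=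
  fun _ hs => hs.1

theorem invariantSpace_antitone : Antitone (invariantSpace : Setoid X → MeasurableSpace X) :=
  fun _ _ hEF _ hs => ⟨hs.1, fun x y hxy => hs.2 x y (hEF hxy)⟩

theorem measurable_invariantSpace {E : Setoid X} {h : X → ℝ} (hm : Measurable h)
    (hinv : ∀ x y, E x y → h x = h y) : Measurable[invariantSpace E] h :=
  fun s hs => ⟨hm hs, fun x y hxy hx => by
    rw [Set.mem_preimage] at hx ⊢
    rwa [← hinv x y hxy]⟩

theorem eq_of_measurable_invariantSpace {E : Setoid X} {h : X → ℝ}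
    (hm : Measurable[invariantSpace E] h) {x y : X} (hxy : E x y) : h x = h y :=
  ((hm (measurableSet_singleton (h x))).2 x y hxy rfl).symm

theorem IsHyperfiniteWitness.le {E : Setoid X} {En : ℕ → Setoid X}
    (h : IsHyperfiniteWitness E En) (n : ℕ) : En n ≤ E :=
  fun {x y} hxy => (h.exhausts x y).2 ⟨n, hxy⟩

/-- Invariance under the union `E` is invariance under every `En n`. This is why the limit does not
depend on the witness. -/
theorem IsHyperfiniteWitness.iInf_invariantSpace {E : Setoid X} {En : ℕ → Setoid X}
    (h : IsHyperfiniteWitness E En) : ⨅ n, invariantSpace (En n) = invariantSpace E := by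
  refine le_antisymm (fun s hs => ?_) (le_iInf fun n => invariantSpace_antitone (h.le n))
  rw [MeasurableSpace.measurableSet_iInf] at hs
  refine ⟨(hs 0).1, fun x y hxy => ?_⟩
  obtain ⟨n, hn⟩ := (h.exhausts x y).1 hxy
  exact (hs n).2 x y hn

theorem isFiniteMeasure_weightedMeasure {μ : Measure X} {w : X → ℝ} (hw : Integrable w μ) :
    IsFiniteMeasure (weightedMeasure μ w) :=
  isFiniteMeasure_withDensity_ofReal hw.2

theorem ae_mul_eq_of_ae_eq_weightedMeasure {μ : Measure X} {w f g : X → ℝ} (hw : Measurable w)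
    (hw0 : ∀ x, 0 ≤ w x) (h : f =ᵐ[weightedMeasure μ w] g) :
    ∀ᵐ x ∂μ, f x * w x = g x * w x := by
  rw [EventuallyEq, weightedMeasure, ae_withDensity_iff hw.ennreal_ofReal] at h
  filter_upwards [h] with x hx
  by_cases hwx : w x = 0
  · simp [hwx]
  · rw [hx (by simpa using lt_of_le_of_ne (hw0 x) (Ne.symm hwx))]

theorem indicator_weightSupport_ae_eq {E : Setoid X} {μ : Measure X} {w : X → ℝ}
    (hw : Measurable w) (g : X → ℝ) :
    (weightSupport E w).indicator g =ᵐ[weightedMeasure μ w] g := by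
  rw [EventuallyEq, weightedMeasure, ae_withDensity_iff hw.ennreal_ofReal]
  refine Eventually.of_forall fun x hx => Set.indicator_of_mem ?_ g
  refine ⟨x, E.refl x, fun h0 => hx ?_⟩
  simp [h0]

variable [StandardBorelSpace X]

theorem IsFiniteBorel.measurable_classSum_of_nonneg {F : Setoid X} (hF : IsFiniteBorel F)
    {h : X → ℝ} (hm : Measurable h) (hh : ∀ x, 0 ≤ h x) : Measurable (classSum F h) := by
  have : classSum F h = fun x => (∫⁻ y, ENNReal.ofReal (h y) ∂(classMeasure F x)).toReal := by
    funext x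
    rw [← hF.ofReal_classSum hh, ENNReal.toReal_ofReal (classSum_nonneg hh F x)]
  rw [this]
  exact (hF.measurable_lintegral_classMeasure (c := fun p => ENNReal.ofReal (h p.2))
    (hm.comp measurable_snd).ennreal_ofReal).ennreal_toReal

theorem IsFiniteBorel.measurable_relMean_of_nonneg {F : Setoid X} (hF : IsFiniteBorel F)
    {w f : X → ℝ} (hw : Measurable w) (hw0 : ∀ x, 0 ≤ w x) (hf : Measurable f)
    (hf0 : ∀ x, 0 ≤ f x) : Measurable (relMean w f F) := by
  have : relMean w f F = fun x => classSum F (fun y => f y * w y) x / classSum F w x :=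
    funext fun x => relMean_eq_div w f F x
  rw [this]
  exact (hF.measurable_classSum_of_nonneg (hf.mul hw) fun x => mul_nonneg (hf0 x) (hw0 x)).div
    (hF.measurable_classSum_of_nonneg hw hw0)

/-- Let `W` be the class sum of `w`, and let `x ∈ Y` send mass `w x / W x * (f y * w y)` to each `y`
in its class. The mass sent is `w x` times the mean at `x`. The mass received is `f x * w x`,
because `W` is constant on the class and the weights `w y / W` sum to 1. -/
theorem IsFiniteBorel.setLIntegral_relMean {E F : Setoid X} (hF : IsFiniteBorel F)
    {μ : Measure X} (hμ : PreservesMeasure E μ) (hFE : F ≤ E) {w f : X → ℝ} (hw : Measurable w)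
    (hw0 : ∀ x, 0 ≤ w x) (hf : Measurable f) (hf0 : ∀ x, 0 ≤ f x) {Y : Set X}
    (hY : MeasurableSet Y) (hYi : IsInvariant F Y) :
    ∫⁻ x in Y, ENNReal.ofReal (relMean w f F x) ∂(weightedMeasure μ w) =
      ∫⁻ x in Y, ENNReal.ofReal (f x) ∂(weightedMeasure μ w) := by
  have hW := hF.measurable_classSum_of_nonneg hw hw0
  have hfw0 : ∀ x, 0 ≤ f x * w x := fun x => mul_nonneg (hf0 x) (hw0 x)
  have hWpos : ∀ x, 0 ≤ classSum F w x := classSum_nonneg hw0 F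
  have hr := hF.measurable_relMean_of_nonneg hw hw0 hf hf0
  let a : X → ENNReal := Y.indicator fun x => ENNReal.ofReal (w x / classSum F w x)
  have ha : Measurable a := (hw.div hW).ennreal_ofReal.indicator hY
  let c : X × X → ENNReal := fun p => a p.1 * ENNReal.ofReal (f p.2 * w p.2)
  have hc : Measurable c :=
    (ha.comp measurable_fst).mul ((hf.mul hw).comp measurable_snd).ennreal_ofReal
  have key := hF.mass_transport hμ hFE hc
  have hconv : ∀ h : X → ℝ, Measurable h →
      ∫⁻ x in Y, ENNReal.ofReal (h x) ∂(weightedMeasure μ w) =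
        ∫⁻ x, Y.indicator (fun x => ENNReal.ofReal (w x) * ENNReal.ofReal (h x)) x ∂μ := by
    intro h hm
    rw [weightedMeasure, restrict_withDensity hY,
      lintegral_withDensity_eq_lintegral_mul _ hw.ennreal_ofReal hm.ennreal_ofReal,
      lintegral_indicator hY]
    rfl
  rw [hconv _ hr, hconv _ hf]
  calc _ = ∫⁻ x, ∫⁻ y, c (x, y) ∂(classMeasure F x) ∂μ := by
        refine lintegral_congr fun x => ?_
        simp only [c]
        rw [lintegral_const_mul (a x) (f := fun y => ENNReal.ofReal (f y * w y))
          (hf.mul hw).ennreal_ofReal, ← hF.ofReal_classSum hfw0]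
        by_cases hx : x ∈ Y
        · simp only [a, Set.indicator_of_mem hx]
          rw [← ENNReal.ofReal_mul (hw0 x),
            ← ENNReal.ofReal_mul (div_nonneg (hw0 x) (hWpos x)), relMean_eq_div]
          congr 1
          ring
        · simp only [a, Set.indicator_of_notMem hx, zero_mul]
    _ = ∫⁻ x, ∫⁻ y, c (y, x) ∂(classMeasure F x) ∂μ := key
    _ = _ := by
        refine lintegral_congr fun x => ?_
        have hcx : ∫⁻ y, c (y, x) ∂(classMeasure F x) =
            ∫⁻ y, Y.indicator (fun x => ENNReal.ofReal (f x * w x / classSum F w x)) x *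
              ENNReal.ofReal (w y) ∂(classMeasure F x) := by
          refine lintegral_congr_ae ?_
          filter_upwards [hF.ae_classMeasure x] with y hxy
          by_cases hx : x ∈ Y
          · have hy : y ∈ Y := hYi x y hxy hx
            simp only [c, a, Set.indicator_of_mem hx, Set.indicator_of_mem hy]
            rw [← classSum_congr_class hxy, ← ENNReal.ofReal_mul (div_nonneg (hw0 y) (hWpos x)),
              ← ENNReal.ofReal_mul (div_nonneg (hfw0 x) (hWpos x))]
            congr 1
            ring
          · have hy : y ∉ Y := fun hy => hx (hYi y x (F.symm hxy) hy)
            simp only [c, a, Set.indicator_of_notMem hx, Set.indicator_of_notMem hy, zero_mul]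
        rw [hcx, lintegral_const_mul _ hw.ennreal_ofReal, ← hF.ofReal_classSum hw0]
        by_cases hx : x ∈ Y
        · simp only [Set.indicator_of_mem hx]
          rw [← ENNReal.ofReal_mul (hw0 x), ← ENNReal.ofReal_mul (div_nonneg (hfw0 x) (hWpos x))]
          congr 1
          -- If the class has weight 0 then `w x = 0`, and both sides vanish.
          rcases (hWpos x).eq_or_lt with h0 | h0
          · have : w x = 0 :=
              le_antisymm (h0 ▸ hF.le_classSum hw0 (F.refl x)) (hw0 x)
            simp [this]
          · field_simp
        · simp only [Set.indicator_of_notMem hx, zero_mul]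

theorem IsFiniteBorel.relMean_ae_eq_condExp_of_nonneg {E F : Setoid X} (hF : IsFiniteBorel F)
    {μ : Measure X} (hμ : PreservesMeasure E μ) (hFE : F ≤ E) {w f : X → ℝ} (hw : Measurable w)
    (hw0 : ∀ x, 0 ≤ w x) (hwi : Integrable w μ) (hf : Measurable f) (hf0 : ∀ x, 0 ≤ f x)
    (hfi : Integrable f (weightedMeasure μ w)) :
    relMean w f F =ᵐ[weightedMeasure μ w] (weightedMeasure μ w)[f | invariantSpace F] := by
  have := isFiniteMeasure_weightedMeasure hwi
  have hr := hF.measurable_relMean_of_nonneg hw hw0 hf hf0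
  have hr0 := relMean_nonneg hw0 hf0 F
  have hri : Integrable (relMean w f F) (weightedMeasure μ w) := by
    refine (lintegral_ofReal_ne_top_iff_integrable hr.aestronglyMeasurable
      (Eventually.of_forall hr0)).1 ?_
    have h := hF.setLIntegral_relMean hμ hFE hw hw0 hf hf0 MeasurableSet.univ
      (fun _ _ _ h => h)
    rw [Measure.restrict_univ] at h
    rw [h]
    exact (lintegral_ofReal_ne_top_iff_integrable hf.aestronglyMeasurable
      (Eventually.of_forall hf0)).2 hfi
  refine ae_eq_condExp_of_forall_setIntegral_eq (invariantSpace_le F) hfi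
    (fun s _ _ => hri.integrableOn) (fun s hs _ => ?_)
    (measurable_invariantSpace hr
      fun x y hxy => relMean_congr_class hxy).stronglyMeasurable.aestronglyMeasurable
  rw [integral_eq_lintegral_of_nonneg_ae (Eventually.of_forall hr0) hr.aestronglyMeasurable,
    integral_eq_lintegral_of_nonneg_ae (Eventually.of_forall hf0) hf.aestronglyMeasurable,
    hF.setLIntegral_relMean hμ hFE hw hw0 hf hf0 hs.1 hs.2]

/-- Means only involve `f * w`, which changes on a `μ`-null set; the `F`-saturation of that set is
null. -/
theorem IsFiniteBorel.relMean_congr_ae {E F : Setoid X} (hF : IsFiniteBorel F)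
    {μ : Measure X} (hμ : PreservesMeasure E μ) (hFE : F ≤ E) {w f g : X → ℝ} (hw : Measurable w)
    (hw0 : ∀ x, 0 ≤ w x) (h : f =ᵐ[weightedMeasure μ w] g) :
    relMean w f F =ᵐ[μ] relMean w g F := by
  filter_upwards [hF.ae_forall_class hμ hFE (ae_mul_eq_of_ae_eq_weightedMeasure hw hw0 h)]
    with x hx
  rw [relMean_eq_div, relMean_eq_div]
  congr 1
  exact finsum_mem_congr rfl fun y hy => hx y hy

/-- The means of `f` over the classes of a finite Borel subrelation are a conditional expectation
of `f` given the σ-algebra of invariant sets. -/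
theorem IsFiniteBorel.relMean_ae_eq_condExp {E F : Setoid X} (hF : IsFiniteBorel F)
    {μ : Measure X} (hμ : PreservesMeasure E μ) (hFE : F ≤ E) {w f : X → ℝ} (hw : Measurable w)
    (hw0 : ∀ x, 0 ≤ w x) (hwi : Integrable w μ) (hfi : Integrable f (weightedMeasure μ w)) :
    relMean w f F =ᵐ[weightedMeasure μ w] (weightedMeasure μ w)[f | invariantSpace F] := by
  set ν := weightedMeasure μ w with hν
  have hac : ν ≪ μ := withDensity_absolutelyContinuous _ _
  let g := hfi.aemeasurable.mk f
  have hg : Measurable g := hfi.aemeasurable.measurable_mk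
  have hfg : f =ᵐ[ν] g := hfi.aemeasurable.ae_eq_mk
  have hgi : Integrable g ν := hfi.congr hfg
  have hpos : Integrable (fun x => max (g x) 0) ν := hgi.pos_part
  have hneg : Integrable (fun x => max (-g x) 0) ν := hgi.neg_part
  have hsplit : g = (fun x => max (g x) 0) - fun x => max (-g x) 0 := by
    funext x
    simp only [Pi.sub_apply]
    rcases le_total (g x) 0 with h | h
    · rw [max_eq_right h, max_eq_left (by linarith)]; ring
    · rw [max_eq_left h, max_eq_right (by linarith)]; ring
  have h1 := hF.relMean_ae_eq_condExp_of_nonneg hμ hFE hw hw0 hwi (hg.max measurable_const)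
    (fun x => le_max_right _ _) hpos
  have h2 := hF.relMean_ae_eq_condExp_of_nonneg hμ hFE hw hw0 hwi
    (f := fun x => max (-g x) 0) (hg.neg.max measurable_const) (fun x => le_max_right _ _) hneg
  have h3 := condExp_sub hpos hneg (invariantSpace F)
  rw [← hsplit] at h3
  refine (hac.ae_eq (hF.relMean_congr_ae hμ hFE hw hw0 hfg)).trans ?_
  refine EventuallyEq.trans ?_ (condExp_congr_ae hfg).symm
  filter_upwards [h1, h2, h3] with x hx1 hx2 hx3
  rw [hx3, Pi.sub_apply, ← hx1, ← hx2, ← hF.relMean_sub, ← hsplit]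

theorem IsHyperfiniteWitness.ae_tendsto_relMean {E : Setoid X} {En : ℕ → Setoid X}
    (h : IsHyperfiniteWitness E En) {μ : Measure X} (hμ : PreservesMeasure E μ) {w f : X → ℝ}
    (hw : Measurable w) (hw0 : ∀ x, 0 ≤ w x) (hwi : Integrable w μ)
    (hf : Integrable f (weightedMeasure μ w)) :
    ∀ᵐ x ∂μ, Tendsto (fun n => relMean w f (En n) x) atTop (𝓝 ((weightSupport E w).indicator
      ((weightedMeasure μ w)[f | invariantSpace E]) x)) := by
  have := isFiniteMeasure_weightedMeasure hwi
  set g := (weightedMeasure μ w)[f | invariantSpace E] with hg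
  have hconv : ∀ᵐ x ∂(weightedMeasure μ w),
      Tendsto (fun n => relMean w f (En n) x) atTop (𝓝 (g x)) := by
    have hlim := tendsto_ae_condExp_iInf (fun i j hij => invariantSpace_antitone (h.monotone hij))
      (fun n => invariantSpace_le (En n)) hf
    rw [h.iInf_invariantSpace] at hlim
    filter_upwards [hlim, ae_all_iff.2 fun n =>
      (h.isFiniteBorel n).relMean_ae_eq_condExp hμ (h.le n) hw hw0 hwi hf] with x hx hxn
    simpa only [hxn] using hx
  rw [weightedMeasure, ae_withDensity_iff hw.ennreal_ofReal] at hconv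
  -- For `μ`-a.e. `x`, convergence holds at every `E`-equivalent point of nonzero weight.
  filter_upwards [ae_all_iff.2 fun n =>
    (h.isFiniteBorel n).ae_forall_class hμ (h.le n) hconv] with x hx
  by_cases hxs : x ∈ weightSupport E w
  · rw [Set.indicator_of_mem hxs]
    obtain ⟨y, hxy, hy⟩ := hxs
    obtain ⟨n, hn⟩ := (h.exhausts x y).1 hxy
    have hty := hx n y hn (by simpa using lt_of_le_of_ne (hw0 y) (Ne.symm hy))
    -- The chosen version of the conditional expectation is measurable everywhere, not just up to
    -- null sets, so it is exactly constant on `E`-classes.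
    have hgm : Measurable[invariantSpace E] g := stronglyMeasurable_condExp.measurable
    rw [eq_of_measurable_invariantSpace hgm hxy]
    refine hty.congr' ?_
    filter_upwards [eventually_ge_atTop n] with k hk
    exact (relMean_congr_class (h.monotone hk hn)).symm
  · rw [Set.indicator_of_notMem hxs]
    have hzero : ∀ n, relMean w f (En n) x = 0 := fun n => by
      have : classSum (En n) w x = 0 := finsum_mem_eq_zero_of_forall_eq_zero fun y hy => by
        by_contra hwy
        exact hxs ⟨y, h.le n hy, hwy⟩
      rw [relMean_eq_div, this, div_zero]
    simp only [hzero]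
    exact tendsto_const_nhds

end Means

end HyperfiniteMeans

end

theorem mainTheorem9 {X : Type*} [MeasurableSpace X] [StandardBorelSpace X]
    (μ : Measure X) (E : Setoid X)
    (hE : HyperfiniteMeans.IsHyperfinite E)
    (hμ : HyperfiniteMeans.PreservesMeasure E μ)
    (w : X → ℝ) (hw_meas : Measurable w) (hw_nonneg : ∀ x, 0 ≤ w x) (hw_int : Integrable w μ)
    (f : X → ℝ) (hf : Integrable f (HyperfiniteMeans.weightedMeasure μ w)) :
    ∃ g : X → ℝ,
      (∀ En : ℕ → Setoid X, HyperfiniteMeans.IsHyperfiniteWitness E En →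
        ∀ᵐ x ∂μ, Tendsto (fun n => HyperfiniteMeans.relMean w f (En n) x) atTop (𝓝 (g x))) ∧
      Integrable g (HyperfiniteMeans.weightedMeasure μ w) ∧
      (∀ Y : Set X, MeasurableSet Y → HyperfiniteMeans.IsInvariant E Y →
        ∫ x in Y, g x ∂(HyperfiniteMeans.weightedMeasure μ w) =
          ∫ x in Y, f x ∂(HyperfiniteMeans.weightedMeasure μ w)) ∧
      eLpNorm g 1 (HyperfiniteMeans.weightedMeasure μ w) ≤
        eLpNorm f 1 (HyperfiniteMeans.weightedMeasure μ w) := by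
  have := HyperfiniteMeans.isFiniteMeasure_weightedMeasure hw_int
  set ν := HyperfiniteMeans.weightedMeasure μ w with hν
  have hae : (HyperfiniteMeans.weightSupport E w).indicator
      (ν[f | HyperfiniteMeans.invariantSpace E]) =ᵐ[ν] ν[f | HyperfiniteMeans.invariantSpace E] :=
    HyperfiniteMeans.indicator_weightSupport_ae_eq hw_meas _
  -- The indicator sets the limit to 0 on classes of zero weight. These are `ν`-null, so integrals
  -- are unaffected, but they may have positive `μ`-measure.
  refine ⟨(HyperfiniteMeans.weightSupport E w).indicator
    (ν[f | HyperfiniteMeans.invariantSpace E]), fun En hEn => ?_, ?_, fun Y hY hYi => ?_, ?_⟩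
  · exact hEn.ae_tendsto_relMean hμ hw_meas hw_nonneg hw_int hf
  · exact integrable_condExp.congr hae.symm
  · rw [integral_congr_ae (ae_restrict_of_ae hae)]
    exact setIntegral_condExp (HyperfiniteMeans.invariantSpace_le E) hf ⟨hY, hYi⟩
  · rw [eLpNorm_congr_ae hae]
    exact eLpNorm_condExp_le_eLpNorm f le_rfl
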